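/- Let $\mathbb N=\{1,2,3,\dots\}$. For every countable limit ordinal $\beta$ fix a sequence $(\beta_n)_{n\in\mathbb N}$ of ordinals $<\beta$ that increases to $\beta$. The Schreier families $\mathrm S_\alpha$ $(\alpha<\omega_1)$ of finite subsets of $\mathbb N$ are defined recursively by $\mathrm S_0=\{\{n\}:n\in\mathbb N\}$; $\mathrm S_{\alpha+1}=\{\bigcup_{j=1}^nE_j : n\in\mathbb N,\ E_1,\dots,E_n\in \mathrm S_\alpha,\ n\le \min E_1,\ \max E_j<\min E_{j+1}\text{ for }1\le j<n\}$; and, for a limit ordinal $\beta$, $\mathrm S_\beta=\{A : A\in \mathrm S_{\beta_n}\text{ and } n\le\min A\text{ for some }n\in\mathbb N\}$. Let $\mathrm S_\alpha(\mathbb Z)=\{\sum_{i\in G}c_ie_i : G\in \mathrm S_\alpha,\ c_i\in\mathbb Z\}\subset \mathrm c_0$, where $(e_i)$ is the unit vector basis of the real Banach space $\mathrm c_0$, with the metric $d_\infty(x,y)=\|x-y\|_\infty$. A metric space $X$ coarsely embeds into a metric space $Y$ if there are a map $f:X\to Y$ and non-decreasing functions $\rho,\omega:[0,\infty)\to[0,\infty)$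 with $\lim_{t\to\infty}\rho(t)=\infty$ and $\rho(d_X(x,y))\le d_Y(f(x),f(y))\le\omega(d_X(x,y))$ for all $x,y\in X$. Corollary. Let $(M,d)$ be a separable metric space. If for every $\alpha<\omega_1$ the metric space $(\mathrm S_\alpha(\mathbb Z),d_\infty)$ coarsely embeds into $M$, then $\mathrm c_0$ coarsely embeds into $M^4$ equipped with the metric $\max_{1\le k\le 4}d(x_k,y_k)$. (No set-theoretic axioms beyond ZFC are assumed.) -/

import Mathlib

open Filter Topology
open scoped NNReal Ordinal ZeroAtInfty

/-- `X` coarsely embeds into `Y`: there are non-decreasing `ρ, σ : [0,∞) → [0,∞)` with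
`ρ(t) → ∞` as `t → ∞`, and a map `f : X → Y` with
`ρ (d(x,y)) ≤ d(f x, f y) ≤ σ (d(x,y))` for all `x, y`. -/
def CoarselyEmbeds (X Y : Type*) [MetricSpace X] [MetricSpace Y] : Prop :=
  ∃ ρ σ : ℝ≥0 → ℝ≥0, Monotone ρ ∧ Monotone σ ∧ Tendsto ρ atTop atTop ∧
    ∃ f : X → Y, ∀ x y : X,
      ρ (nndist x y) ≤ nndist (f x) (f y) ∧ nndist (f x) (f y) ≤ σ (nndist x y)

/-- `a` assigns to every countable limit ordinal `β` a sequence of ordinals below `β` which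
increases to `β`. (The values at other ordinals are irrelevant, and so is the term of index `0`.) -/
def IsLimitChoice (a : Ordinal.{0} → ℕ → Ordinal.{0}) : Prop :=
  ∀ β : Ordinal.{0}, β < ω₁ → Order.IsSuccLimit β →
    Monotone (a β) ∧ (∀ n, a β n < β) ∧ IsLUB (Set.range (a β)) β

/-- `Schreier a α A` says that `A` belongs to the Schreier family `S_α` of finite subsets of
`{1, 2, 3, …}`, where `a β` is the sequence used at the limit ordinal `β`. -/
inductive Schreier (a : Ordinal.{0} → ℕ → Ordinal.{0}) : Ordinal.{0} → Finset ℕ → Prop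
  /-- `S_0` consists of the singletons. -/
  | zero (n : ℕ) (hn : 1 ≤ n) : Schreier a 0 {n}
  /-- `S_{α+1}` consists of the unions of `E_1, …, E_n ∈ S_α` with `n ≤ E_1 < ⋯ < E_n`. -/
  | succ (α : Ordinal.{0}) (n : ℕ) (hn : 1 ≤ n) (E : Fin n → Finset ℕ)
      (hE : ∀ i, Schreier a α (E i))
      (hmin : ∀ i, ∀ x ∈ E i, n ≤ x)
      (hlt : ∀ i j, i < j → ∀ x ∈ E i, ∀ y ∈ E j, x < y) :
      Schreier a (α + 1) (Finset.univ.biUnion E)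
  /-- `S_β`, for a limit `β`, consists of the `A` with `n ≤ A` and `A ∈ S_{a β n}`
  for some `n`. -/
  | limit (β : Ordinal.{0}) (hβ : Order.IsSuccLimit β) (n : ℕ) (hn : 1 ≤ n) (A : Finset ℕ)
      (hmin : ∀ x ∈ A, n ≤ x) (hA : Schreier a (a β n) A) : Schreier a β A

/-! The three recursion equations for the Schreier families. -/

theorem schreier_zero_iff (a : Ordinal.{0} → ℕ → Ordinal.{0}) (A : Finset ℕ) :
    Schreier a 0 A ↔ ∃ n : ℕ, 1 ≤ n ∧ A = {n} := by
  constructor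
  · intro h
    generalize hα : (0 : Ordinal.{0}) = α at h
    cases h with
    | zero n hn => exact ⟨n, hn, rfl⟩
    | succ α n hn E hE hmin hlt => exact absurd hα.symm (by simp)
    | limit _ hβ => exact absurd (hα ▸ hβ) (by simp)
  · rintro ⟨n, hn, rfl⟩
    exact .zero n hn

theorem schreier_succ_iff (a : Ordinal.{0} → ℕ → Ordinal.{0}) (α : Ordinal.{0})
    (A : Finset ℕ) :
    Schreier a (α + 1) A ↔ ∃ n : ℕ, 1 ≤ n ∧ ∃ E : Fin n → Finset ℕ,
      (∀ i, Schreier a α (E i)) ∧ (∀ i, ∀ x ∈ E i, n ≤ x) ∧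
      (∀ i j, i < j → ∀ x ∈ E i, ∀ y ∈ E j, x < y) ∧ A = Finset.univ.biUnion E := by
  constructor
  · intro h
    generalize hα : α + 1 = γ at h
    cases h with
    | zero n hn => exact absurd hα (by simp)
    | succ α' n hn E hE hmin hlt =>
      obtain rfl : α = α' := by simpa using hα
      exact ⟨n, hn, E, hE, hmin, hlt, rfl⟩
    | limit _ hβ =>
      subst hα
      exact absurd hβ (by simp [← Order.succ_eq_add_one])
  · rintro ⟨n, hn, E, hE, hmin, hlt, rfl⟩
    exact .succ α n hn E hE hmin hlt

theorem schreier_limit_iff (a : Ordinal.{0} → ℕ → Ordinal.{0}) (β : Ordinal.{0})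
    (hβ : Order.IsSuccLimit β) (A : Finset ℕ) :
    Schreier a β A ↔ ∃ n : ℕ, 1 ≤ n ∧ (∀ x ∈ A, n ≤ x) ∧ Schreier a (a β n) A := by
  constructor
  · intro h
    cases h with
    | zero n hn => exact absurd hβ (by simp)
    | succ α n hn E hE hmin hlt => exact absurd hβ (by simp [← Order.succ_eq_add_one])
    | limit _ _ n hn _ hmin hA => exact ⟨n, hn, hmin, hA⟩
  · rintro ⟨n, hn, hmin, hA⟩
    exact .limit β hβ n hn A hmin hA

/-- The set of all `∑_{i ∈ G} c_i e_i` with `G ∈ 𝒢` and all `c_i ∈ 𝔼`, as a subset of the real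
Banach space `c₀`, which is `C₀(ℕ, ℝ)` with the supremum norm. As a type it carries the metric
`d_∞` inherited from `c₀`. -/
def supportedIn (𝒢 : Set (Finset ℕ)) (𝔼 : Set ℝ) : Set C₀(ℕ, ℝ) :=
  {x | ∃ G ∈ 𝒢, (∀ i ∈ G, x i ∈ 𝔼) ∧ ∀ i ∉ G, x i = 0}

/-- The metric space `(S_α(ℤ), d_∞)`. -/
abbrev schreierSpace (a : Ordinal.{0} → ℕ → Ordinal.{0}) (α : Ordinal.{0}) :
    Set C₀(ℕ, ℝ) :=
  supportedIn {A | Schreier a α A} (Set.range ((↑) : ℤ → ℝ))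

/-! Already `M` contains a coarse copy of `c₀`; the diagonal carries it into the power. Finitely
supported integer vectors are 1/2-dense in `c₀`, so it suffices to embed those.

For each countable `α`, round the embedding of the Schreier space to a dense sequence. An injective
list `u` of points in a common Schreier set relabels vectors isometrically, so it yields a word over
a countable alphabet: images of the relabelled vectors, and values of the moduli. The tree of such
lists has rank at least `α` (`schreier_rankGE`). As a countable supremum of countable ordinals is
countable, some infinite word `w` has all its prefixes realised at every countable rank
(`exists_forall_cofinal`). Each required inequality reads only finitely many letters, so the map
coded by `w` inherits it (`c₀_coarselyEmbeds`). -/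

namespace SchreierCoarse

/-! ### Ranks of families of finite sets -/

/-- `RankGE 𝒢 β n u`: the points `u 0, …, u (n - 1)` are distinct and lie in a common member of `𝒢`,
and in the tree of all such finite sequences this sequence has rank at least `β`. -/
inductive RankGE (𝒢 : Set (Finset ℕ)) : Ordinal.{0} → ℕ → (ℕ → ℕ) → Prop
  | intro (β : Ordinal.{0}) (n : ℕ) (u : ℕ → ℕ) (hinj : Set.InjOn u (Set.Iio n))
      (hcov : ∃ G ∈ 𝒢, ∀ i < n, u i ∈ G) (m : Ordinal.{0} → ℕ)
      (hext : ∀ γ < β, RankGE 𝒢 γ (n + 1) (Function.update u n (m γ))) : RankGE 𝒢 β n u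

namespace RankGE

variable {𝒢 : Set (Finset ℕ)} {β γ : Ordinal.{0}} {n : ℕ} {u : ℕ → ℕ}

theorem injOn (h : RankGE 𝒢 β n u) : Set.InjOn u (Set.Iio n) := by
  cases h; assumption

theorem exists_mem (h : RankGE 𝒢 β n u) : ∃ G ∈ 𝒢, ∀ i < n, u i ∈ G := by
  cases h; assumption

theorem exists_update (h : RankGE 𝒢 β n u) (hγ : γ < β) :
    ∃ m, RankGE 𝒢 γ (n + 1) (Function.update u n m) := by
  cases h with
  | intro _ _ _ _ _ m hext => exact ⟨m γ, hext γ hγ⟩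

theorem mono (h : RankGE 𝒢 β n u) (hγ : γ ≤ β) : RankGE 𝒢 γ n u := by
  cases h with
  | intro _ _ _ hinj hcov m hext => exact .intro _ _ _ hinj hcov m fun δ hδ => hext δ (hδ.trans_le hγ)

theorem of_forall_exists (hinj : Set.InjOn u (Set.Iio n)) (hcov : ∃ G ∈ 𝒢, ∀ i < n, u i ∈ G)
    (h : ∀ γ < β, ∃ m, RankGE 𝒢 γ (n + 1) (Function.update u n m)) : RankGE 𝒢 β n u := by
  choose! m hm using h
  exact .intro _ _ _ hinj hcov m hm

end RankGE

theorem injOn_update {u : ℕ → ℕ} {n N m : ℕ} (hu : Set.InjOn u (Set.Iio n))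
    (hN : ∀ i < n, u i < N) (hm : N ≤ m) :
    Set.InjOn (Function.update u n m) (Set.Iio (n + 1)) := by
  intro i hi j hj hij
  simp only [Set.mem_Iio] at hi hj
  by_cases hin : i = n <;> by_cases hjn : j = n
  · rw [hin, hjn]
  · have := hN j (by omega)
    simp only [hin, Function.update_self, Function.update_of_ne hjn] at hij
    omega
  · have := hN i (by omega)
    simp only [hjn, Function.update_self, Function.update_of_ne hin] at hij
    omega
  · rw [Function.update_of_ne hin, Function.update_of_ne hjn] at hij
    exact hu (show i < n by omega) (show j < n by omega) hij

/-! ### Schreier families have large rank -/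

section Schreier

variable {a : Ordinal.{0} → ℕ → Ordinal.{0}}

theorem schreier_singleton (ha : IsLimitChoice a) {k : ℕ} (hk : 1 ≤ k) (α : Ordinal.{0}) :
    α < ω₁ → Schreier a α {k} := by
  induction α using Ordinal.limitRecOn with
  | zero => exact fun _ => .zero k hk
  | add_one α ih =>
    intro hα
    have hα' : α < ω₁ := (lt_add_one α).trans hα
    exact (schreier_succ_iff a α _).2 ⟨1, le_rfl, fun _ => {k}, fun _ => ih hα', by simpa using hk,
      fun i j hij => absurd hij (by simp [Subsingleton.elim i j]), by simp⟩
  | limit β hβ ih =>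
    intro hα
    have h1 := (ha β hα hβ).2.1 1
    exact .limit β hβ 1 le_rfl _ (by simpa using hk) (ih _ h1 (h1.trans hα))

theorem schreier_insert (ha : IsLimitChoice a) {k : ℕ} (hk : 2 ≤ k) {α : Ordinal.{0}} (hα : α < ω₁)
    {A : Finset ℕ} (hA : Schreier a α A) (hkA : ∀ x ∈ A, k < x) :
    Schreier a (α + 1) (insert k A) := by
  refine (schreier_succ_iff a α _).2 ⟨2, by norm_num, ![{k}, A], ?_, ?_, ?_, ?_⟩
  · simpa [Fin.forall_fin_two] using ⟨schreier_singleton ha (by omega) α hα, hA⟩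
  · simpa [Fin.forall_fin_two] using ⟨hk, fun x hx => by have := hkA x hx; omega⟩
  · simpa [Fin.forall_fin_two] using hkA
  · ext x
    simp [Fin.exists_fin_two]

/-- Allowing any `𝒢` and a prefix `u` below `N` makes the induction close: only Schreier sets beyond
`N` need be compatible with `u`. As nothing is assumed hereditary, compatibility means inclusion in
a member of `𝒢`. -/
theorem rankGE_of_schreier (ha : IsLimitChoice a) (α : Ordinal.{0}) :
    α < ω₁ → ∀ (𝒢 : Set (Finset ℕ)) (n : ℕ) (u : ℕ → ℕ) (N : ℕ), Set.InjOn u (Set.Iio n) →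
      (∀ i < n, u i < N) →
      (∀ A, Schreier a α A → (∀ x ∈ A, N ≤ x) → ∃ G ∈ 𝒢, A ⊆ G ∧ ∀ i < n, u i ∈ G) →
      RankGE 𝒢 α n u := by
  induction α using Ordinal.limitRecOn with
  | zero =>
    intro hα 𝒢 n u N hu hN h𝒢
    obtain ⟨G, hG, -, hGu⟩ := h𝒢 {N + 1} (.zero _ (by omega)) (by simp)
    exact .of_forall_exists hu ⟨G, hG, hGu⟩ fun γ hγ => absurd hγ (by simp)
  | add_one α ih =>
    intro hα 𝒢 n u N hu hN h𝒢
    have hα' : α < ω₁ := (lt_add_one α).trans hα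
    obtain ⟨G, hG, -, hGu⟩ := h𝒢 {N + 1} (schreier_singleton ha (by omega) _ hα) (by simp)
    -- The new point is at least 2, so it and a later set of the previous family form an admissible
    -- union of two pieces.
    refine .of_forall_exists hu ⟨G, hG, hGu⟩ fun γ hγ => ⟨N + 2, ?_⟩
    refine RankGE.mono ?_ (Order.lt_add_one_iff.1 hγ)
    refine ih hα' 𝒢 (n + 1) _ (N + 3) (injOn_update hu hN (by omega)) ?_ ?_
    · intro i hi
      rcases eq_or_ne i n with rfl | hin
      · simp
      · rw [Function.update_of_ne hin]
        have := hN i (by omega)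
        omega
    · intro A hA hNA
      obtain ⟨G, hG, hAG, hGu⟩ := h𝒢 (insert (N + 2) A)
        (schreier_insert ha (by omega) hα' hA fun x hx => by have := hNA x hx; omega)
        (by
          intro x hx
          rcases Finset.mem_insert.1 hx with rfl | hx
          · omega
          · have := hNA x hx
            omega)
      refine ⟨G, hG, (Finset.subset_insert _ _).trans hAG, fun i hi => ?_⟩
      rcases eq_or_ne i n with rfl | hin
      · simpa using hAG (Finset.mem_insert_self _ _)
      · rw [Function.update_of_ne hin]
        exact hGu i (by omega)
  | limit β hβ ih =>
    intro hα 𝒢 n u N hu hN h𝒢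
    obtain ⟨hmono, hlt, hlub⟩ := ha β hα hβ
    obtain ⟨G, hG, -, hGu⟩ := h𝒢 {N + 1} (schreier_singleton ha (by omega) _ hα) (by simp)
    refine .of_forall_exists hu ⟨G, hG, hGu⟩ fun γ hγ => ?_
    obtain ⟨_, ⟨k, rfl⟩, hk⟩ := (lt_isLUB_iff hlub).1 hγ
    -- The shift to `k + 1` avoids the meaningless index 0; raising `N` to at least `k + 1` supplies
    -- the limit clause's condition on the minimum.
    refine RankGE.exists_update (β := a β (k + 1)) ?_ (hk.trans_le (hmono (Nat.le_succ k)))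
    refine ih _ (hlt _) ((hlt _).trans hα) 𝒢 n u (max N (k + 1)) hu
      (fun i hi => (hN i hi).trans_le (le_max_left _ _)) fun A hA hNA => ?_
    exact h𝒢 A (.limit β hβ (k + 1) (by omega) A (fun x hx => (le_max_right _ _).trans (hNA x hx)) hA)
      fun x hx => (le_max_left _ _).trans (hNA x hx)

theorem schreier_rankGE (ha : IsLimitChoice a) {α : Ordinal.{0}} (hα : α < ω₁) (u : ℕ → ℕ) :
    RankGE {A | Schreier a α A} α 0 u :=
  rankGE_of_schreier ha α hα _ 0 u 0 (by simp) (by simp) fun A hA _ => ⟨A, hA, subset_rfl, by simp⟩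

end Schreier

/-! ### Branches through families of trees of unbounded rank -/

/-- The prefix `w 0, …, w (n - 1)` is realised by sequences of arbitrarily large countable rank. -/
def Cofinal {C : Type*} (𝒢 : Ordinal.{0} → Set (Finset ℕ)) (W : Ordinal.{0} → (ℕ → ℕ) → ℕ → C)
    (n : ℕ) (w : ℕ → C) : Prop :=
  ∀ β < ω₁, ∃ α u, RankGE (𝒢 α) β n u ∧ ∀ i < n, W α u i = w i

section Branch

variable {C : Type*} {𝒢 : Ordinal.{0} → Set (Finset ℕ)} {W : Ordinal.{0} → (ℕ → ℕ) → ℕ → C}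

theorem Cofinal.congr {n : ℕ} {w w' : ℕ → C} (h : Cofinal 𝒢 W n w) (hw : ∀ i < n, w i = w' i) :
    Cofinal 𝒢 W n w' := fun β hβ => by
  obtain ⟨α, u, hu, hW⟩ := h β hβ
  exact ⟨α, u, hu, fun i hi => (hW i hi).trans (hw i hi)⟩

/-- If every letter failed, each at its own countable rank, a node of rank above the supremum of
these would have a child contradicting the failure of its own letter. -/
theorem Cofinal.exists_update [Countable C]
    (hW : ∀ α u v i, (∀ j < i, u j = v j) → W α u i = W α v i) {n : ℕ} {w : ℕ → C}
    (h : Cofinal 𝒢 W n w) : ∃ c, Cofinal 𝒢 W (n + 1) (Function.update w n c) := by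
  by_contra! hcon
  simp only [Cofinal] at hcon
  push Not at hcon
  choose b hb hcon using hcon
  have hsup : (⨆ c, b c) < ω₁ := Ordinal.iSup_lt_omega_one hb
  have hbdd : BddAbove (Set.range b) := ⟨ω₁, by rintro _ ⟨c, rfl⟩; exact (hb c).le⟩
  obtain ⟨α, u, hu, hWu⟩ := h _ ((Cardinal.isSuccLimit_omega 1).add_one_lt hsup)
  obtain ⟨m, hm⟩ := hu.exists_update (lt_add_one _)
  have hupd : ∀ i ≤ n, W α (Function.update u n m) i = W α u i := fun i hi =>
    hW _ _ _ _ fun j hj => Function.update_of_ne (by omega) _ _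
  obtain ⟨i, hi, hne⟩ := hcon (W α u n) α _ (hm.mono (le_ciSup hbdd _))
  rw [hupd i (by omega)] at hne
  rcases eq_or_ne i n with rfl | hin
  · exact hne (by simp)
  · rw [Function.update_of_ne hin] at hne
    exact hne (hWu i (by omega))

/-- Only the word converges: `α` and `u` may change with the prefix length and the rank. -/
theorem exists_forall_cofinal [Countable C] [Nonempty C]
    (hW : ∀ α u v i, (∀ j < i, u j = v j) → W α u i = W α v i)
    (h : ∀ β < ω₁, ∃ α u, RankGE (𝒢 α) β 0 u) : ∃ w : ℕ → C, ∀ n, Cofinal 𝒢 W n w := by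
  classical
  have h0 : ∀ w, Cofinal 𝒢 W 0 w := fun w β hβ => by
    obtain ⟨α, u, hu⟩ := h β hβ
    exact ⟨α, u, hu, by simp⟩
  have hstep : ∀ n (w : ℕ → C), ∃ c, Cofinal 𝒢 W n w →
      Cofinal 𝒢 W (n + 1) (Function.update w n c) := fun n w => by
    by_cases hw : Cofinal 𝒢 W n w
    · obtain ⟨c, hc⟩ := hw.exists_update hW
      exact ⟨c, fun _ => hc⟩
    · exact ⟨Classical.arbitrary C, fun h => absurd h hw⟩
  choose c hc using hstep
  let s : ℕ → ℕ → C := fun n => Nat.rec (fun _ => Classical.arbitrary C)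
    (fun n w => Function.update w n (c n w)) n
  have hs : ∀ n, s (n + 1) = Function.update (s n) n (c n (s n)) := fun n => rfl
  have hgood : ∀ n, Cofinal 𝒢 W n (s n) := fun n => by
    induction n with
    | zero => exact h0 _
    | succ n ih => rw [hs]; exact hc n _ ih
  have hcoh : ∀ n, ∀ i < n, s n i = s (i + 1) i := fun n => by
    induction n with
    | zero => intro i hi; omega
    | succ n ih =>
      intro i hi
      rcases eq_or_ne i n with rfl | hin
      · rfl
      · rw [hs n, Function.update_of_ne hin]
        exact ih i (by omega)
  exact ⟨fun i => s (i + 1) i, fun n => (hgood n).congr (hcoh n)⟩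

end Branch

/-! ### Integer vectors of finite support in `c₀` -/

/-- The supremum norm of a finitely supported integer vector. -/
def supNorm (x : ℕ →₀ ℤ) : ℕ := x.support.sup fun i => (x i).natAbs

theorem supNorm_le_iff {x : ℕ →₀ ℤ} {k : ℕ} : supNorm x ≤ k ↔ ∀ i, (x i).natAbs ≤ k := by
  rw [supNorm, Finset.sup_le_iff]
  refine ⟨fun h i => ?_, fun h i _ => h i⟩
  by_cases hi : i ∈ x.support
  · exact h i hi
  · simp [Finsupp.notMem_support_iff.1 hi]

theorem natAbs_le_supNorm (x : ℕ →₀ ℤ) (i : ℕ) : (x i).natAbs ≤ supNorm x :=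
  supNorm_le_iff.1 le_rfl i

theorem supNorm_mapDomain {u : ℕ → ℕ} {x : ℕ →₀ ℤ} (hu : Set.InjOn u x.support) :
    supNorm (x.mapDomain u) = supNorm x := by
  classical
  rw [supNorm, supNorm, Finsupp.mapDomain_support_of_injOn x hu, Finset.sup_image]
  refine Finset.sup_congr rfl fun i hi => ?_
  simp [Finsupp.mapDomain_apply' _ x subset_rfl hu hi]

theorem supNorm_mapDomain_sub {u : ℕ → ℕ} {n : ℕ} {x y : ℕ →₀ ℤ} (hu : Set.InjOn u (Set.Iio n))
    (hx : ∀ i ∈ x.support, i < n) (hy : ∀ i ∈ y.support, i < n) :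
    supNorm (x.mapDomain u - y.mapDomain u) = supNorm (x - y) := by
  classical
  have hsub : x.mapDomain u - y.mapDomain u = (x - y).mapDomain u :=
    (map_sub (Finsupp.mapDomain.addMonoidHom u) x y).symm
  rw [hsub, supNorm_mapDomain]
  refine hu.mono fun i hi => ?_
  rcases Finset.mem_union.1 (Finsupp.support_sub hi) with h | h
  · exact hx i h
  · exact hy i h

/-- A finitely supported integer vector as an element of `c₀`. -/
def toC₀ (x : ℕ →₀ ℤ) : C₀(ℕ, ℝ) where
  toFun i := x i
  continuous_toFun := continuous_of_discreteTopology
  zero_at_infty' := by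
    refine tendsto_const_nhds.congr' ?_
    rw [Filter.EventuallyEq, cocompact_eq_cofinite, Nat.cofinite_eq_atTop, eventually_atTop]
    refine ⟨x.support.sup id + 1, fun i hi => ?_⟩
    have : i ∉ x.support := fun h => by
      have := Finset.le_sup (f := id) h
      simp only [id] at this
      omega
    simp [Finsupp.notMem_support_iff.1 this]

@[simp] theorem toC₀_apply (x : ℕ →₀ ℤ) (i : ℕ) : toC₀ x i = x i := rfl

theorem dist_c₀_le_iff {f g : C₀(ℕ, ℝ)} {r : ℝ} (hr : 0 ≤ r) :
    dist f g ≤ r ↔ ∀ i, dist (f i) (g i) ≤ r := by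
  rw [← ZeroAtInftyContinuousMap.dist_toBCF_eq_dist, BoundedContinuousFunction.dist_le hr]
  rfl

theorem dist_apply_le (f g : C₀(ℕ, ℝ)) (i : ℕ) : dist (f i) (g i) ≤ dist f g :=
  (dist_c₀_le_iff dist_nonneg).1 le_rfl i

theorem dist_toC₀ (x y : ℕ →₀ ℤ) : dist (toC₀ x) (toC₀ y) = supNorm (x - y) := by
  have key : ∀ i, dist (toC₀ x i) (toC₀ y i) = (((x - y) i).natAbs : ℝ) := fun i => by
    rw [toC₀_apply, toC₀_apply, Real.dist_eq, Finsupp.sub_apply, Nat.cast_natAbs]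
    push_cast
    rfl
  apply le_antisymm
  · rw [dist_c₀_le_iff (Nat.cast_nonneg _)]
    intro i
    rw [key]
    exact_mod_cast natAbs_le_supNorm _ i
  · rw [← Nat.le_floor_iff dist_nonneg, supNorm_le_iff]
    intro i
    rw [Nat.le_floor_iff dist_nonneg, ← key]
    exact dist_apply_le _ _ i

theorem exists_dist_toC₀_le (f : C₀(ℕ, ℝ)) : ∃ x : ℕ →₀ ℤ, dist f (toC₀ x) ≤ 1 / 2 := by
  have hf : Tendsto f atTop (𝓝 0) := by
    rw [← Nat.cofinite_eq_atTop, ← cocompact_eq_cofinite]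
    exact f.zero_at_infty'
  obtain ⟨N, hN⟩ := Metric.tendsto_atTop.1 hf (1 / 2) (by norm_num)
  refine ⟨Finsupp.onFinset (Finset.range N) (fun i => if i < N then round (f i) else 0)
    fun i hi => ?_, (dist_c₀_le_iff (by norm_num)).2 fun i => ?_⟩
  · by_contra h
    simp_all
  · rw [toC₀_apply, Finsupp.onFinset_apply]
    split_ifs with hi
    · rw [Real.dist_eq]
      exact abs_sub_round _
    · simpa using (hN i (not_lt.1 hi)).le

theorem mapDomain_mem_supportedIn {𝒢 : Set (Finset ℕ)} {u : ℕ → ℕ} {n : ℕ} {G : Finset ℕ}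
    (hG : G ∈ 𝒢) (hu : ∀ i < n, u i ∈ G) {x : ℕ →₀ ℤ} (hx : ∀ i ∈ x.support, i < n) :
    toC₀ (x.mapDomain u) ∈ supportedIn 𝒢 (Set.range ((↑) : ℤ → ℝ)) := by
  classical
  refine ⟨G, hG, fun i _ => ⟨_, rfl⟩, fun i hi => ?_⟩
  have : i ∉ (x.mapDomain u).support := fun h => by
    obtain ⟨j, hj, rfl⟩ := Finset.mem_image.1 (Finsupp.mapDomain_support h)
    exact hi (hu j (hx j hj))
  simp [Finsupp.notMem_support_iff.1 this]

/-- An enumeration of all finitely supported integer vectors whose `i`-th term is supported in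
`{0, …, i - 1}`. -/
theorem exists_enumeration : ∃ e : ℕ → ℕ →₀ ℤ,
    (∀ i, ∀ j ∈ (e i).support, j < i) ∧ Function.Surjective e := by
  classical
  obtain ⟨g, hg⟩ := exists_surjective_nat (ℕ →₀ ℤ)
  -- Each `g k` recurs at all indices `Nat.pair k l`, hence at one beyond its support.
  refine ⟨fun i => if ∀ j ∈ (g i.unpair.1).support, j < i then g i.unpair.1 else 0,
    fun i j hj => ?_, fun x => ?_⟩
  · dsimp only at hj
    split_ifs at hj with h
    · exact h j hj
    · simp at hj
  · obtain ⟨k, rfl⟩ := hg x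
    refine ⟨Nat.pair k ((g k).support.sup id + 1), ?_⟩
    have h : ∀ j ∈ (g k).support, j < Nat.pair k ((g k).support.sup id + 1) := fun j hj => by
      have h1 := Finset.le_sup (f := id) hj
      have h2 := Nat.right_le_pair k ((g k).support.sup id + 1)
      simp only [id] at h1
      omega
    simp only [Nat.unpair_pair]
    rw [if_pos h]

/-! ### Coarse embeddings -/

section Coarse

variable {M : Type*} [MetricSpace M]

/-- The inequalities of a coarse embedding at a pair of points at integer distance `k` which are
mapped to `p` and `q`; the moduli are encoded by the sequences `S` and `R`. -/
def CoarseBounds (S R : ℕ → ℕ) (k : ℕ) (p q : M) : Prop :=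
  dist p q ≤ S k ∧ ∀ m : ℕ, R m ≤ k → (m : ℝ) ≤ dist p q

/-- Rounding moves each image by less than 1, hence distances by at most 2; both moduli absorb this.
-/
theorem exists_coarseBounds [TopologicalSpace.SeparableSpace M] [Nonempty M] {X : Set C₀(ℕ, ℝ)}
    (h : CoarselyEmbeds X M) : ∃ (Φ : (ℕ →₀ ℤ) → ℕ) (S R : ℕ → ℕ), ∀ x y, toC₀ x ∈ X → toC₀ y ∈ X →
      CoarseBounds S R (supNorm (x - y)) (TopologicalSpace.denseSeq M (Φ x))
        (TopologicalSpace.denseSeq M (Φ y)) := by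
  obtain ⟨ρ, σ, -, -, hρ, f, hf⟩ := h
  have happrox : ∀ x : ℕ →₀ ℤ, ∃ i, ∀ hx : toC₀ x ∈ X,
      dist (f ⟨toC₀ x, hx⟩) (TopologicalSpace.denseSeq M i) < 1 := fun x => by
    by_cases hx : toC₀ x ∈ X
    · obtain ⟨i, hi⟩ := (TopologicalSpace.denseRange_denseSeq M).exists_dist_lt
        (f ⟨toC₀ x, hx⟩) one_pos
      exact ⟨i, fun _ => hi⟩
    · exact ⟨0, fun h => absurd h hx⟩
  choose Φ hΦ using happrox
  have hR : ∀ m : ℕ, ∃ r : ℕ, ∀ t : ℝ≥0, (r : ℝ≥0) ≤ t → (m + 2 : ℝ≥0) ≤ ρ t := fun m => by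
    obtain ⟨t₀, ht₀⟩ := eventually_atTop.1 (tendsto_atTop.1 hρ (m + 2))
    obtain ⟨r, hr⟩ := exists_nat_ge t₀
    exact ⟨r, fun t ht => ht₀ t (hr.trans ht)⟩
  choose R hR using hR
  refine ⟨Φ, fun k => ⌈σ k⌉₊ + 2, R, fun x y hx hy => ?_⟩
  have hk : nndist (⟨toC₀ x, hx⟩ : X) ⟨toC₀ y, hy⟩ = (supNorm (x - y) : ℝ≥0) := by
    ext
    rw [coe_nndist, Subtype.dist_eq, dist_toC₀]
    rfl
  obtain ⟨hlow, hup⟩ := hf ⟨toC₀ x, hx⟩ ⟨toC₀ y, hy⟩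
  rw [hk] at hlow hup
  have hx1 := hΦ x hx
  have hy1 := hΦ y hy
  set p := f ⟨toC₀ x, hx⟩
  set q := f ⟨toC₀ y, hy⟩
  set p' := TopologicalSpace.denseSeq M (Φ x)
  set q' := TopologicalSpace.denseSeq M (Φ y)
  have h1 : dist p' q' ≤ dist p q + 2 := by
    have := dist_triangle4 p' p q q'
    rw [dist_comm p' p] at this
    linarith
  have h2 : dist p q ≤ dist p' q' + 2 := by
    have := dist_triangle4 p p' q' q
    rw [dist_comm q' q] at this
    linarith
  refine ⟨?_, fun m hm => ?_⟩
  · have h3 : dist p q ≤ ⌈σ (supNorm (x - y))⌉₊ := by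
      have := hup.trans (Nat.le_ceil _)
      exact_mod_cast this
    push_cast
    linarith
  · have h3 : ((m + 2 : ℝ≥0) : ℝ) ≤ dist p q :=
      NNReal.coe_le_coe.2 ((hR m _ (Nat.cast_le.2 hm)).trans hlow)
    push_cast at h3
    linarith

theorem coarselyEmbeds_of_coarseBounds {S R : ℕ → ℕ} {F : (ℕ →₀ ℤ) → M}
    (hF : ∀ x y, CoarseBounds S R (supNorm (x - y)) (F x) (F y)) :
    CoarselyEmbeds C₀(ℕ, ℝ) M := by
  choose g hg using exists_dist_toC₀_le
  -- The range keeps the supremum finite; the `+ 1` pays for rounding two points of `c₀` by 1/2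
  -- each.
  let ρ : ℝ≥0 → ℕ := fun t => ((Finset.range (⌊t⌋₊ + 1)).filter fun m => (R m : ℝ≥0) + 1 ≤ t).sup id
  let σ : ℝ≥0 → ℕ := fun t => (Finset.range (⌊t⌋₊ + 2)).sup S
  have hρ : Monotone ρ := fun s t hst => by
    refine Finset.sup_mono fun m hm => ?_
    simp only [Finset.mem_filter, Finset.mem_range] at hm ⊢
    have := Nat.floor_mono hst
    exact ⟨by omega, hm.2.trans hst⟩
  have hσ : Monotone σ := fun s t hst => by
    refine Finset.sup_mono fun m hm => ?_
    simp only [Finset.mem_range] at hm ⊢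
    have := Nat.floor_mono hst
    omega
  refine ⟨fun t => ρ t, fun t => σ t, fun s t hst => Nat.cast_le.2 (hρ hst),
    fun s t hst => Nat.cast_le.2 (hσ hst), ?_, fun x => F (g x), fun x y => ?_⟩
  · refine tendsto_natCast_atTop_atTop.comp (tendsto_atTop.2 fun m => ?_)
    filter_upwards [eventually_ge_atTop (m : ℝ≥0), eventually_ge_atTop ((R m : ℝ≥0) + 1)]
      with t h1 h2
    refine Finset.le_sup (f := id) ?_
    simp only [Finset.mem_filter, Finset.mem_range]
    exact ⟨Nat.lt_succ_of_le (Nat.le_floor h1), h2⟩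
  · obtain ⟨hup, hlow⟩ := hF (g x) (g y)
    have hk := dist_toC₀ (g x) (g y)
    set k := supNorm (g x - g y)
    have h1 : (k : ℝ) ≤ dist x y + 1 := by
      have := dist_triangle4 (toC₀ (g x)) x y (toC₀ (g y))
      rw [dist_comm (toC₀ (g x)) x] at this
      linarith [hg x, hg y]
    have h2 : dist x y ≤ k + 1 := by
      have := dist_triangle4 x (toC₀ (g x)) (toC₀ (g y)) y
      rw [dist_comm (toC₀ (g y)) y] at this
      linarith [hg x, hg y]
    constructor
    · have : ∀ m ∈ (Finset.range (⌊nndist x y⌋₊ + 1)).filter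
          fun m => (R m : ℝ≥0) + 1 ≤ nndist x y, m ≤ ⌊nndist (F (g x)) (F (g y))⌋₊ := fun m hm => by
        have hm2 := NNReal.coe_le_coe.2 (Finset.mem_filter.1 hm).2
        push_cast at hm2
        have hm3 : (R m : ℝ) ≤ k := by linarith
        refine Nat.le_floor (NNReal.coe_le_coe.1 ?_)
        push_cast
        exact hlow m (by exact_mod_cast hm3)
      exact (Nat.cast_le.2 (Finset.sup_le this)).trans (Nat.floor_le zero_le)
    · have hkt : k ≤ ⌊nndist x y + 1⌋₊ := Nat.le_floor (NNReal.coe_le_coe.1 (by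
        push_cast
        exact h1))
      rw [Nat.floor_add_one zero_le] at hkt
      have h3 : S k ≤ σ (nndist x y) := Finset.le_sup (Finset.mem_range.2 (by omega))
      refine NNReal.coe_le_coe.1 ?_
      push_cast
      exact hup.trans (by exact_mod_cast h3)

theorem coarselyEmbeds_pi_const {X ι : Type*} [MetricSpace X] [Fintype ι] [Nonempty ι]
    (h : CoarselyEmbeds X M) : CoarselyEmbeds X (ι → M) := by
  obtain ⟨ρ, σ, hρ, hσ, hρ', f, hf⟩ := h
  exact ⟨ρ, σ, hρ, hσ, hρ', fun x _ => f x, fun x y => by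
    rw [nndist_pi_const]
    exact hf x y⟩

theorem c₀_coarselyEmbeds [TopologicalSpace.SeparableSpace M] {a : Ordinal.{0} → ℕ → Ordinal.{0}}
    (ha : IsLimitChoice a)
    (hM : ∀ α : Ordinal.{0}, α < ω₁ → CoarselyEmbeds (schreierSpace a α) M) :
    CoarselyEmbeds C₀(ℕ, ℝ) M := by
  have : Nonempty M := by
    obtain ⟨-, -, -, -, -, f, -⟩ := hM 0 (Ordinal.omega_pos 1)
    exact ⟨f ⟨0, {1}, .zero 1 le_rfl, fun i _ => ⟨0, by simp⟩, fun i _ => rfl⟩⟩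
  have hex : ∀ α : Ordinal.{0}, ∃ (Φ : (ℕ →₀ ℤ) → ℕ) (S R : ℕ → ℕ), α < ω₁ → ∀ x y,
      toC₀ x ∈ schreierSpace a α → toC₀ y ∈ schreierSpace a α →
      CoarseBounds S R (supNorm (x - y)) (TopologicalSpace.denseSeq M (Φ x))
        (TopologicalSpace.denseSeq M (Φ y)) := fun α => by
    by_cases hα : α < ω₁
    · obtain ⟨Φ, S, R, h⟩ := exists_coarseBounds (hM α hα)
      exact ⟨Φ, S, R, fun _ => h⟩
    · exact ⟨0, 0, 0, fun h => absurd h hα⟩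
  choose Φ S R hbounds using hex
  obtain ⟨e, he, hesurj⟩ := exists_enumeration
  -- Putting `α < ω₁` into membership lets any realised prefix certify that `α` is countable.
  let 𝒢 : Ordinal.{0} → Set (Finset ℕ) := fun α => {A | α < ω₁ ∧ Schreier a α A}
  let W : Ordinal.{0} → (ℕ → ℕ) → ℕ → ℕ × ℕ × ℕ := fun α u i =>
    (Φ α ((e i).mapDomain u), S α i, R α i)
  have hW : ∀ α u v i, (∀ j < i, u j = v j) → W α u i = W α v i := fun α u v i huv => by
    simp only [W]
    rw [Finsupp.mapDomain_congr fun j hj => huv j (he i j hj)]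
  obtain ⟨w, hw⟩ := exists_forall_cofinal (𝒢 := 𝒢) hW fun β hβ =>
    ⟨β, id, by simpa [𝒢, hβ] using schreier_rankGE ha hβ id⟩
  choose code hcode using hesurj
  refine coarselyEmbeds_of_coarseBounds (S := fun k => (w k).2.1) (R := fun m => (w m).2.2)
    (F := fun x => TopologicalSpace.denseSeq M (w (code x)).1) fun x y => ?_
  have main : ∀ m, ∃ α u, ∃ N, code x < N ∧ code y < N ∧ supNorm (x - y) < N ∧ m < N ∧
      (∀ i < N, W α u i = w i) ∧ CoarseBounds (S α) (R α) (supNorm (x - y))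
        (TopologicalSpace.denseSeq M (Φ α (x.mapDomain u)))
        (TopologicalSpace.denseSeq M (Φ α (y.mapDomain u))) := fun m => by
    -- A prefix this long fixes both images and the moduli at `supNorm (x - y)` and `m`. Rank 0 then
    -- suffices.
    set N := code x + code y + supNorm (x - y) + m + 1 with hN
    obtain ⟨α, u, hu, hWu⟩ := hw N 0 (Ordinal.omega_pos 1)
    obtain ⟨G, ⟨hα, hG⟩, hGu⟩ := hu.exists_mem
    have hx : ∀ i ∈ x.support, i < N := fun i hi => by
      have := he (code x) i (by rwa [hcode])
      omega
    have hy : ∀ i ∈ y.support, i < N := fun i hi => by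
      have := he (code y) i (by rwa [hcode])
      omega
    refine ⟨α, u, N, by omega, by omega, by omega, by omega, hWu, ?_⟩
    rw [← supNorm_mapDomain_sub hu.injOn hx hy]
    exact hbounds α hα _ _ (mapDomain_mem_supportedIn hG hGu hx)
      (mapDomain_mem_supportedIn hG hGu hy)
  have hΦw : ∀ {α u N} {z : ℕ →₀ ℤ}, (∀ i < N, W α u i = w i) → code z < N →
      Φ α (z.mapDomain u) = (w (code z)).1 := fun {α u N z} h hz => by
    rw [← h _ hz]
    simp only [W, hcode]
  constructor
  · obtain ⟨α, u, N, hxN, hyN, hkN, -, hWu, hb⟩ := main 0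
    dsimp only
    rw [← hΦw hWu hxN, ← hΦw hWu hyN, ← hWu _ hkN]
    exact hb.1
  · intro m hm
    obtain ⟨α, u, N, hxN, hyN, -, hmN, hWu, hb⟩ := main m
    dsimp only at hm ⊢
    rw [← hWu m hmN] at hm
    rw [← hΦw hWu hxN, ← hΦw hWu hyN]
    exact hb.2 m hm

end Coarse

end SchreierCoarse

/-- `Fin 4 → M` is `M⁴` with the maximum metric. -/
theorem mainTheorem8 {M : Type*} [MetricSpace M] [TopologicalSpace.SeparableSpace M]
    (a : Ordinal.{0} → ℕ → Ordinal.{0}) (ha : IsLimitChoice a)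
    (hM : ∀ α : Ordinal.{0}, α < ω₁ → CoarselyEmbeds (schreierSpace a α) M) :
    CoarselyEmbeds C₀(ℕ, ℝ) (Fin 4 → M) :=
  SchreierCoarse.coarselyEmbeds_pi_const (SchreierCoarse.c₀_coarselyEmbeds ha hM)
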